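/- Let $M\ge 2$ be an integer ($M=2J$, where $J$ is the spin). For $N\in\mathbb N$ let $\mathfrak M_N$ be the set of finitely supported functions $\mathfrak m:\mathbb Z\to\{0,1,\dots,M\}$ with $\sum_x\mathfrak m(x)=N$. Write $\mathfrak m\sim\mathfrak n$ if there are $x,y\in\mathbb Z$ with $|x-y|=1$ such that $\mathfrak m(x)=\mathfrak n(x)+1$, $\mathfrak n(y)=\mathfrak m(y)+1$ and $\mathfrak m=\mathfrak n$ at all other sites. In that case put $$w(\mathfrak m,\mathfrak n)=\prod_{x:\mathfrak m(x)\ne\mathfrak n(x)}\Big(\tfrac M2\big(\mathfrak m(x)+\mathfrak n(x)+1\big)-\mathfrak m(x)\mathfrak n(x)\Big)^{1/2}.$$ For $\Delta>0$, the $N$-particle Hamiltonian of the spin-$J$ XXZ chain with anisotropy $\Delta$ is the bounded self-adjoint operator on $\ell^2(\mathfrak M_N)$ given by $$(H^Nf)(\mathfrak m)=-\frac1{2\Delta}\sum_{\mathfrak n\sim\mathfrak m}w(\mathfrak m,\mathfrak n)f(\mathfrak n)+V_N(\mathfrak m)f(\mathfrak m),$$ $$V_N(\mathfrak m)=\sum_{x\in\mathbb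 Z}\Big(\tfrac M2\big(\mathfrak m(x)+\mathfrak m(x+1)\big)-\mathfrak m(x)\mathfrak m(x+1)\Big).$$ Let $\widehat H=\bigoplus_{k\ge2}H^{kM}$ be the (unbounded) direct sum on $\bigoplus_{k\ge 2}\ell^2(\mathfrak M_{kM})$, with its natural domain $\{(f_k)_k:\sum_k\|H^{kM}f_k\|^2<\infty\}$. Say that a non-empty open interval $(a,b)\subset\mathbb R$ is a gap in the spectrum of an operator if it contains no point of the spectrum, while the spectrum has points in $(-\infty,a]$ and in $[b,\infty)$. Then there is a constant $C=C(M)$, depending only on $M$, such that for every $\Delta>M^3+2M^{3/2}+M$ there are real numbers $a<b$, not depending on $k$, with $$M^2\le a\le M^2+\frac{C}{\Delta^2},\qquad \Big(1-\frac M\Delta\Big)(M^2+1)-\frac{C}{\Delta^2}\le b\le\Big(1-\frac M\Delta\Big)(M^2+1),$$ such that $(a,b)$ is a gap in the spectrum of $H^{kM}$ for every integer $k\ge2$, and is also a gap in the spectrum of $\widehat H$. -/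

import Mathlib

open scoped ENNReal

namespace XXZChain

noncomputable section

/-- Configurations of `N` particles on the chain `ℤ` with at most `M` particles per site. -/
def Config (M N : ℕ) : Type :=
  {m : ℤ →₀ ℕ // (∀ x, m x ≤ M) ∧ (m.sum fun _ a => a) = N}

namespace Config

variable {M N : ℕ}

instance : CoeFun (Config M N) (fun _ => ℤ → ℕ) := ⟨fun m => m.1⟩

theorem ext' {m n : Config M N} (h : ∀ x, m x = n x) : m = n :=
  Subtype.ext (Finsupp.ext h)

end Config

/-- The configurations `m` and `n` are adjacent: `n` arises from `m` by moving exactly one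
particle along an edge of the chain, from `x` to a neighbouring site `y`. -/
def Hop {M N : ℕ} (m n : Config M N) : Prop :=
  ∃ x y : ℤ, |x - y| = 1 ∧ m x = n x + 1 ∧ n y = m y + 1 ∧
    ∀ z, z ≠ x → z ≠ y → m z = n z

theorem Hop.symm {M N : ℕ} {m n : Config M N} (h : Hop m n) : Hop n m := by
  obtain ⟨x, y, hxy, h1, h2, h3⟩ := h
  exact ⟨y, x, by rw [abs_sub_comm]; exact hxy, h2, h1, fun z hy hx => (h3 z hx hy).symm⟩

/-- The `N`-particle graph over the chain with maximal local occupation number `M`. -/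
def particleGraph (M N : ℕ) : SimpleGraph (Config M N) where
  Adj := Hop
  symm := ⟨fun _ _ h => h.symm⟩
  loopless := ⟨fun m ⟨x, _, _, h, _⟩ => by omega⟩

/-- The weight `w(m, n) = ∏_{x : m(x) ≠ n(x)} (M/2 (m(x) + n(x) + 1) - m(x) n(x))^{1/2}`. -/
def weight {M N : ℕ} (m n : Config M N) : ℝ :=
  ∏ x ∈ m.1.neLocus n.1,
    Real.sqrt ((M : ℝ) / 2 * ((m x : ℝ) + (n x : ℝ) + 1) - (m x : ℝ) * (n x : ℝ))

/-- The two-site interaction potential `v(a, b) = M/2 (a + b) - a b`. -/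
def pairPotential (M a b : ℕ) : ℝ :=
  (M : ℝ) / 2 * ((a : ℝ) + (b : ℝ)) - (a : ℝ) * (b : ℝ)

/-- The total interaction potential `V_N(m)`: the sum of `v` over the edges `{x, x + 1}` of the
chain (finitely many summands are non-zero). -/
def potential {M N : ℕ} (m : Config M N) : ℝ :=
  ∑ᶠ x : ℤ, pairPotential M (m x) (m (x + 1))

/-- The Hilbert space `ℓ²(𝔐_N)` of `N` particles. -/
abbrev NSpace (M N : ℕ) : Type := lp (fun _ : Config M N => ℂ) 2

/-! ### Boundedness of the operators -/

theorem weight_comm {M N : ℕ} (m n : Config M N) : weight m n = weight n m := by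
  unfold weight
  rw [Finsupp.neLocus_comm]
  refine Finset.prod_congr rfl fun x _ => ?_
  congr 1
  ring

theorem weight_nonneg {M N : ℕ} (m n : Config M N) : 0 ≤ weight m n :=
  Finset.prod_nonneg fun _ _ => Real.sqrt_nonneg _

theorem card_support_le {M N : ℕ} (m : Config M N) : m.1.support.card ≤ N := by
  have h := m.2.2
  rw [Finsupp.sum] at h
  calc m.1.support.card = ∑ x ∈ m.1.support, 1 := by simp
    _ ≤ ∑ x ∈ m.1.support, m.1 x :=
        Finset.sum_le_sum fun x hx => Nat.one_le_iff_ne_zero.2 (Finsupp.mem_support_iff.1 hx)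
    _ = N := h

theorem weight_le {M N : ℕ} (m n : Config M N) : weight m n ≤ (M + 1 : ℝ) ^ (2 * N) := by
  have hc : (m.1.neLocus n.1).card ≤ 2 * N := by
    have h1 : m.1.neLocus n.1 ⊆ m.1.support ∪ n.1.support := by
      intro x hx
      rw [Finsupp.mem_neLocus] at hx
      simp only [Finset.mem_union, Finsupp.mem_support_iff]
      omega
    have h2 := Finset.card_le_card h1
    have h3 := Finset.card_union_le m.1.support n.1.support
    have h4 := card_support_le m
    have h5 := card_support_le n
    omega
  have hM : (1 : ℝ) ≤ (M : ℝ) + 1 := by linarith [Nat.cast_nonneg (α := ℝ) M]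
  calc weight m n ≤ ∏ _x ∈ m.1.neLocus n.1, ((M : ℝ) + 1) := by
        refine Finset.prod_le_prod (fun _ _ => Real.sqrt_nonneg _) fun x _ => ?_
        rw [Real.sqrt_le_left (by linarith)]
        have h1 : (m x : ℝ) ≤ M := by exact_mod_cast m.2.1 x
        have h2 : (n x : ℝ) ≤ M := by exact_mod_cast n.2.1 x
        have h3 : (0 : ℝ) ≤ m x := Nat.cast_nonneg _
        have h4 : (0 : ℝ) ≤ n x := Nat.cast_nonneg _
        nlinarith [mul_nonneg h3 h4]
    _ = ((M : ℝ) + 1) ^ (m.1.neLocus n.1).card := by simp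
    _ ≤ _ := pow_le_pow_right₀ hM hc

/-- The site a particle leaves, and the direction in which it moves. -/
theorem exists_hop_code {M N : ℕ} (m : Config M N) :
    ∃ c : Config M N → ℤ × Bool,
      (∀ n, Hop m n → c n ∈ m.1.support ×ˢ (Finset.univ : Finset Bool)) ∧
      Set.InjOn c {n | Hop m n} := by
  classical
  have key : ∀ n, Hop m n → ∃ p : ℤ × Bool, p.1 ∈ m.1.support ∧
      m p.1 = n p.1 + 1 ∧ n (if p.2 then p.1 + 1 else p.1 - 1) =
        m (if p.2 then p.1 + 1 else p.1 - 1) + 1 ∧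
      ∀ z, z ≠ p.1 → z ≠ (if p.2 then p.1 + 1 else p.1 - 1) → m z = n z := by
    rintro n ⟨x, y, hxy, h1, h2, h3⟩
    have hs : x ∈ m.1.support := by
      rw [Finsupp.mem_support_iff]
      omega
    rcases (abs_eq (by norm_num : (0 : ℤ) ≤ 1)).1 hxy with h | h
    · obtain rfl : y = x - 1 := by omega
      exact ⟨(x, false), hs, h1, by simpa using h2, by simpa using h3⟩
    · obtain rfl : y = x + 1 := by omega
      exact ⟨(x, true), hs, h1, by simpa using h2, by simpa using h3⟩
  refine ⟨fun n => if h : Hop m n then (key n h).choose else (0, true), ?_, ?_⟩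
  · intro n hn
    simp only [hn, dif_pos, Finset.mem_product, Finset.mem_univ, and_true]
    exact (key n hn).choose_spec.1
  · intro n hn n' hn' h
    change Hop m n at hn
    change Hop m n' at hn'
    simp only [hn, hn', dif_pos] at h
    have a := (key n hn).choose_spec.2
    have b := (key n' hn').choose_spec.2
    rw [← h] at b
    set p := (key n hn).choose
    refine Config.ext' fun z => ?_
    by_cases hz : z = p.1
    · subst hz
      have := a.1
      have := b.1
      omega
    · by_cases hz' : z = if p.2 then p.1 + 1 else p.1 - 1
      · have h1 := a.2.1
        have h2 := b.2.1
        rw [← hz'] at h1 h2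
        omega
      · rw [← a.2.2 z hz hz', ← b.2.2 z hz hz']

theorem finite_neighbors {M N : ℕ} (m : Config M N) : {n | (particleGraph M N).Adj m n}.Finite := by
  obtain ⟨c, h1, h2⟩ := exists_hop_code m
  exact Set.Finite.of_injOn (t := ↑(m.1.support ×ˢ (Finset.univ : Finset Bool)))
    (fun n hn => h1 n hn) h2 (Finset.finite_toSet _)

/-- The finite set of configurations adjacent to `m`. -/
def neighbors {M N : ℕ} (m : Config M N) : Finset (Config M N) :=
  (finite_neighbors m).toFinset

theorem mem_neighbors {M N : ℕ} {m n : Config M N} :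
    n ∈ neighbors m ↔ (particleGraph M N).Adj m n := by
  simp [neighbors]

theorem card_neighbors_le {M N : ℕ} (m : Config M N) : (neighbors m).card ≤ N * 2 := by
  obtain ⟨c, h1, h2⟩ := exists_hop_code m
  calc (neighbors m).card ≤ (m.1.support ×ˢ (Finset.univ : Finset Bool)).card :=
        Finset.card_le_card_of_injOn c (fun n hn => h1 n (mem_neighbors.1 hn))
          (fun a ha b hb h => h2 (mem_neighbors.1 ha) (mem_neighbors.1 hb) h)
    _ = m.1.support.card * 2 := by simp [Finset.card_product]
    _ ≤ N * 2 := Nat.mul_le_mul_right 2 (card_support_le m)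

theorem sum_weight_le {M N : ℕ} (m : Config M N) :
    ∑ n ∈ neighbors m, |weight m n| ≤ (N * 2 : ℕ) * (M + 1 : ℝ) ^ (2 * N) := by
  have hM : (0 : ℝ) ≤ (M + 1 : ℝ) ^ (2 * N) := by positivity
  calc ∑ n ∈ neighbors m, |weight m n| ≤ ∑ _n ∈ neighbors m, (M + 1 : ℝ) ^ (2 * N) :=
        Finset.sum_le_sum fun n _ => by
          rw [abs_of_nonneg (weight_nonneg m n)]
          exact weight_le m n
    _ = (neighbors m).card * (M + 1 : ℝ) ^ (2 * N) := by simp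
    _ ≤ _ := mul_le_mul_of_nonneg_right (by exact_mod_cast card_neighbors_le m) hM

theorem pairPotential_nonneg {M a b : ℕ} (ha : a ≤ M) (hb : b ≤ M) : 0 ≤ pairPotential M a b := by
  unfold pairPotential
  have h1 : (a : ℝ) ≤ M := by exact_mod_cast ha
  have h2 : (b : ℝ) ≤ M := by exact_mod_cast hb
  have h3 : (0 : ℝ) ≤ a := Nat.cast_nonneg _
  have h4 : (0 : ℝ) ≤ b := Nat.cast_nonneg _
  nlinarith [mul_nonneg h3 (sub_nonneg.2 h2), mul_nonneg h4 (sub_nonneg.2 h1)]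

theorem pairPotential_le (M a b : ℕ) : pairPotential M a b ≤ M / 2 * (a + b) := by
  unfold pairPotential
  have : (0 : ℝ) ≤ (a : ℝ) * b := by positivity
  linarith

theorem abs_potential_le {M N : ℕ} (m : Config M N) : |potential m| ≤ (M : ℝ) * N := by
  classical
  set s : Finset ℤ := m.1.support ∪ m.1.support.image (fun x => x - 1) with hs
  have hsum : ∑ x ∈ m.1.support, (m x : ℝ) = N := by
    have h := m.2.2
    rw [Finsupp.sum] at h
    exact_mod_cast h
  have hV : potential m = ∑ x ∈ s, pairPotential M (m x) (m (x + 1)) := by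
    unfold potential
    refine finsum_eq_sum_of_support_subset _ fun x hx => ?_
    by_contra hxs
    simp only [hs, Finset.coe_union, Finset.coe_image, Set.mem_union, Finset.mem_coe,
      Finsupp.mem_support_iff, Set.mem_image, not_or, not_not, not_exists, not_and] at hxs
    have h2 : m (x + 1) = 0 := by
      by_contra h
      exact hxs.2 (x + 1) h (by ring)
    apply hx
    show pairPotential M (m x) (m (x + 1)) = 0
    rw [show m x = 0 from hxs.1, h2]
    simp [pairPotential]
  have e1 : ∑ x ∈ s, (m x : ℝ) = N := by
    rw [← hsum]
    refine (Finset.sum_subset Finset.subset_union_left fun x _ hx => ?_).symm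
    simpa using hx
  have e2 : ∑ x ∈ s, (m (x + 1) : ℝ) = N := by
    rw [← hsum]
    have h1 : ∑ x ∈ m.1.support.image (fun x => x - 1), (m (x + 1) : ℝ) =
        ∑ x ∈ s, (m (x + 1) : ℝ) := by
      refine Finset.sum_subset Finset.subset_union_right fun x _ hx => ?_
      by_contra h
      refine hx (Finset.mem_image.2 ⟨x + 1, ?_, by ring⟩)
      rw [Finsupp.mem_support_iff]
      exact fun h0 => h (by exact_mod_cast h0)
    rw [← h1, Finset.sum_image (fun a _ b _ h => by simpa using h)]
    simp
  rw [hV, abs_of_nonneg (Finset.sum_nonneg fun x _ =>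
    pairPotential_nonneg (m.2.1 x) (m.2.1 (x + 1)))]
  calc ∑ x ∈ s, pairPotential M (m x) (m (x + 1))
      ≤ ∑ x ∈ s, (M : ℝ) / 2 * ((m x : ℝ) + (m (x + 1) : ℝ)) :=
        Finset.sum_le_sum fun x _ => pairPotential_le _ _ _
    _ = (M : ℝ) / 2 * (∑ x ∈ s, (m x : ℝ) + ∑ x ∈ s, (m (x + 1) : ℝ)) := by
        rw [← Finset.mul_sum, Finset.sum_add_distrib]
    _ = M * N := by
        rw [e1, e2]
        ring

section Kernel

variable {ι : Type*}

theorem sum_kernel_le (s : ι → Finset ι) (hs : ∀ i j, j ∈ s i ↔ i ∈ s j)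
    (K : ι → ι → ℝ) (hK : ∀ i j, K i j = K j i) (D : ℝ) (hD0 : 0 ≤ D)
    (hD : ∀ i, ∑ j ∈ s i, |K i j| ≤ D) (f : lp (fun _ : ι => ℂ) 2) (t : Finset ι) :
    ∑ i ∈ t, ‖∑ j ∈ s i, (K i j : ℂ) * f j‖ ^ (2 : ℝ≥0∞).toReal ≤
      (D * ‖f‖) ^ (2 : ℝ≥0∞).toReal := by
  classical
  have h2 : (2 : ℝ≥0∞).toReal = 2 := by simp
  have row : ∀ i, ‖∑ j ∈ s i, (K i j : ℂ) * f j‖ ^ 2 ≤ D * ∑ j ∈ s i, |K i j| * ‖f j‖ ^ 2 := by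
    intro i
    have a1 : ‖∑ j ∈ s i, (K i j : ℂ) * f j‖ ≤ ∑ j ∈ s i, |K i j| * ‖f j‖ := by
      refine (norm_sum_le _ _).trans (le_of_eq (Finset.sum_congr rfl fun j _ => ?_))
      rw [norm_mul, Complex.norm_real, Real.norm_eq_abs]
    have a2 : (∑ j ∈ s i, |K i j| * ‖f j‖) ^ 2 ≤
        (∑ j ∈ s i, |K i j|) * ∑ j ∈ s i, |K i j| * ‖f j‖ ^ 2 := by
      refine Finset.sum_sq_le_sum_mul_sum_of_sq_le_mul _ (fun j _ => abs_nonneg _)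
        (fun j _ => by positivity) fun j _ => le_of_eq (by ring)
    have a3 : 0 ≤ ∑ j ∈ s i, |K i j| * ‖f j‖ ^ 2 :=
      Finset.sum_nonneg fun j _ => by positivity
    calc _ ≤ (∑ j ∈ s i, |K i j| * ‖f j‖) ^ 2 := pow_le_pow_left₀ (norm_nonneg _) a1 2
      _ ≤ _ := a2
      _ ≤ _ := mul_le_mul_of_nonneg_right (hD i) a3
  have fsum : ∀ u : Finset ι, ∑ j ∈ u, ‖f j‖ ^ 2 ≤ ‖f‖ ^ 2 := by
    intro u
    have := lp.sum_rpow_le_norm_rpow (by simp : 0 < (2 : ℝ≥0∞).toReal) f u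
    simpa [h2] using this
  simp only [h2, Real.rpow_two]
  set u : Finset ι := t.biUnion s with hu
  calc ∑ i ∈ t, ‖∑ j ∈ s i, (K i j : ℂ) * f j‖ ^ 2
      ≤ ∑ i ∈ t, D * ∑ j ∈ s i, |K i j| * ‖f j‖ ^ 2 := Finset.sum_le_sum fun i _ => row i
    _ = D * ∑ i ∈ t, ∑ j ∈ s i, |K i j| * ‖f j‖ ^ 2 := by rw [Finset.mul_sum]
    _ = D * ∑ j ∈ u, ∑ i ∈ t.filter (fun i => j ∈ s i), |K i j| * ‖f j‖ ^ 2 := by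
        congr 1
        refine Finset.sum_comm' fun i j => ?_
        simp only [hu, Finset.mem_filter, Finset.mem_biUnion]
        exact ⟨fun h => ⟨⟨h.1, h.2⟩, i, h.1, h.2⟩, fun h => h.1⟩
    _ ≤ D * ∑ j ∈ u, D * ‖f j‖ ^ 2 := by
        refine mul_le_mul_of_nonneg_left (Finset.sum_le_sum fun j _ => ?_) hD0
        rw [← Finset.sum_mul]
        refine mul_le_mul_of_nonneg_right ?_ (by positivity)
        refine le_trans ?_ (hD j)
        calc ∑ i ∈ t.filter (fun i => j ∈ s i), |K i j|
            = ∑ i ∈ t.filter (fun i => j ∈ s i), |K j i| :=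
              Finset.sum_congr rfl fun i _ => by rw [hK]
          _ ≤ ∑ i ∈ s j, |K j i| := by
              refine Finset.sum_le_sum_of_subset_of_nonneg (fun i hi => ?_)
                fun i _ _ => abs_nonneg _
              exact (hs i j).1 (Finset.mem_filter.1 hi).2
    _ = D * D * ∑ j ∈ u, ‖f j‖ ^ 2 := by rw [← Finset.mul_sum]; ring
    _ ≤ D * D * ‖f‖ ^ 2 := mul_le_mul_of_nonneg_left (fsum u) (by positivity)
    _ = (D * ‖f‖) ^ 2 := by ring

/-- The bounded operator `(T f)(i) = ∑_{j ∈ s i} K(i, j) f(j)` on `ℓ²(ι)` of a symmetric kernel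
with uniformly bounded absolute row sums. -/
def kernelOp (s : ι → Finset ι) (hs : ∀ i j, j ∈ s i ↔ i ∈ s j)
    (K : ι → ι → ℝ) (hK : ∀ i j, K i j = K j i) (D : ℝ) (hD0 : 0 ≤ D)
    (hD : ∀ i, ∑ j ∈ s i, |K i j| ≤ D) :
    lp (fun _ : ι => ℂ) 2 →L[ℂ] lp (fun _ : ι => ℂ) 2 :=
  LinearMap.mkContinuous
    { toFun := fun f => ⟨fun i => ∑ j ∈ s i, (K i j : ℂ) * f j,
        memℓp_gen' (sum_kernel_le s hs K hK D hD0 hD f)⟩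
      map_add' := fun f g => by
        ext i
        simp [mul_add, Finset.sum_add_distrib]
        rfl
      map_smul' := fun c f => by
        ext i
        simp [Finset.mul_sum, mul_left_comm] }
    D fun f => lp.norm_le_of_forall_sum_le (by simp) (by positivity)
      (sum_kernel_le s hs K hK D hD0 hD f)

end Kernel

/-- The weighted adjacency operator `A_N` on `ℓ²(𝔐_N)`. -/
def adjacencyOp (M N : ℕ) : NSpace M N →L[ℂ] NSpace M N :=
  kernelOp neighbors
    (fun m n => by rw [mem_neighbors, mem_neighbors, SimpleGraph.adj_comm])
    weight weight_comm ((N * 2 : ℕ) * (M + 1 : ℝ) ^ (2 * N)) (by positivity) sum_weight_le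

theorem adjacencyOp_apply {M N : ℕ} (f : NSpace M N) (m : Config M N) :
    adjacencyOp M N f m = ∑ n ∈ neighbors m, (weight m n : ℂ) * f n := rfl

/-- The operator `V_N` on `ℓ²(𝔐_N)` of multiplication by the total interaction potential. -/
def potentialOp (M N : ℕ) : NSpace M N →L[ℂ] NSpace M N :=
  kernelOp (fun m => {m}) (fun m n => by simp [eq_comm])
    (fun m n => (potential m + potential n) / 2) (fun m n => by ring)
    ((M : ℝ) * N) (by positivity) (fun m => by simpa using abs_potential_le m)

theorem potentialOp_apply {M N : ℕ} (f : NSpace M N) (m : Config M N) :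
    potentialOp M N f m = (potential m : ℂ) * f m := by
  change ∑ n ∈ ({m} : Finset (Config M N)), (((potential m + potential n) / 2 : ℝ) : ℂ) * f n = _
  simp

/-- The `N`-particle XXZ Hamiltonian `H^N = -(1/(2Δ)) A_N + V_N` of the chain, for spin
`J = M / 2` and anisotropy `Δ`. -/
def hamiltonian (Δ : ℝ) (M N : ℕ) : NSpace M N →L[ℂ] NSpace M N :=
  (-(1 / (2 * Δ) : ℝ) : ℂ) • adjacencyOp M N + potentialOp M N

theorem hamiltonian_apply (Δ : ℝ) {M N : ℕ} (f : NSpace M N) (m : Config M N) :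
    hamiltonian Δ M N f m =
      -(1 / (2 * (Δ : ℂ))) * ∑ n ∈ neighbors m, (weight m n : ℂ) * f n +
        (potential m : ℂ) * f m := by
  have h : hamiltonian Δ M N f m =
      (-(1 / (2 * Δ) : ℝ) : ℂ) * adjacencyOp M N f m + potentialOp M N f m := rfl
  rw [h, adjacencyOp_apply, potentialOp_apply]
  push_cast
  ring

/-! ### Direct sums and spectra of unbounded operators -/

/-- The Hilbert space direct sum of bounded operators `T i`, an in general unbounded operator on
the Hilbert space direct sum, with domain `{f : ∑ ‖T i (f i)‖² < ∞}`. -/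
def directSumOp {ι : Type*} {E : ι → Type*} [∀ i, NormedAddCommGroup (E i)]
    [∀ i, NormedSpace ℂ (E i)] (T : ∀ i, E i →L[ℂ] E i) : lp E 2 →ₗ.[ℂ] lp E 2 where
  domain :=
    { carrier := {f | Memℓp (fun i => T i (f i)) 2}
      add_mem' := fun {f g} hf hg => by
        have h := Memℓp.add hf hg
        have e : (fun i => T i ((f + g) i)) =
            (fun i => T i (f i)) + (fun i => T i (g i)) := by
          ext i
          simp
        show Memℓp (fun i => T i ((f + g) i)) 2
        rw [e]
        exact h
      zero_mem' := by
        show Memℓp (fun i => T i ((0 : lp E 2) i)) 2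
        have e : (fun i => T i ((0 : lp E 2) i)) = 0 := by
          ext i
          simp
        rw [e]
        exact zero_memℓp
      smul_mem' := fun c f hf => by
        have h := Memℓp.const_smul hf c
        have e : (fun i => T i ((c • f) i)) = c • (fun i => T i (f i)) := by
          ext i
          simp
        show Memℓp (fun i => T i ((c • f) i)) 2
        rw [e]
        exact h }
  toFun :=
    { toFun := fun f => ⟨fun i => T i (f.1 i), f.2⟩
      map_add' := fun f g => by
        ext i
        simp
        rfl
      map_smul' := fun c f => by
        ext i
        simp }

/-- The resolvent set of an unbounded operator `T`: those `z` for which `T - z` has a bounded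
everywhere defined two-sided inverse. -/
def unboundedResolventSet {E : Type*} [NormedAddCommGroup E] [NormedSpace ℂ E]
    (T : E →ₗ.[ℂ] E) : Set ℂ :=
  {z | ∃ R : E →L[ℂ] E,
    (∀ g, ∃ h : R g ∈ T.domain, T ⟨R g, h⟩ - z • R g = g) ∧
    ∀ f : T.domain, R (T f - z • (f : E)) = f}

/-- The spectrum of an unbounded operator. -/
def unboundedSpectrum {E : Type*} [NormedAddCommGroup E] [NormedSpace ℂ E]
    (T : E →ₗ.[ℂ] E) : Set ℂ :=
  (unboundedResolventSet T)ᶜ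

/-- The restricted XXZ Hamiltonian `⨁_{k ≥ 2} H^{kM}`. -/
def restrictedHamiltonian (Δ : ℝ) (M : ℕ) :
    lp (fun k : Set.Ici (2 : ℕ) => NSpace M (k * M)) 2 →ₗ.[ℂ]
      lp (fun k : Set.Ici (2 : ℕ) => NSpace M (k * M)) 2 :=
  directSumOp fun k : Set.Ici (2 : ℕ) => hamiltonian Δ M (k * M)

/-- The non-empty open interval `(a, b)` is a gap of the spectrum `σ`: it contains no point of
`σ`, and `σ` has real points on both sides of it. -/
def IsSpectralGap (σ : Set ℂ) (a b : ℝ) : Prop :=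
  a < b ∧ (∀ E : ℝ, a < E → E < b → (E : ℂ) ∉ σ) ∧
    (∃ E : ℝ, E ≤ a ∧ (E : ℂ) ∈ σ) ∧ ∃ E : ℝ, b ≤ E ∧ (E : ℂ) ∈ σ

end

end XXZChain

namespace XXZChain

noncomputable section

/-! ### Summation by parts for the potential; droplets and their isolation. -/

section Potential

variable {M N : ℕ}

/-! The theorem holds with `C = 0`: the gap is exactly between $M^2$ and $(1-M/\Delta)(M^2+1)$. The
proof is a block argument made coercive by a sign flip.

Call a configuration a droplet if $V\le M^2$. The potential is integer valued, so all other
configurations have $V\ge M^2+1$. For $M\ge2$ and $N\ge2M$ two droplets are never adjacent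
(`not_hop_of_potential_le`), because a droplet is sharp on both sides of a full site
(`exists_peak`). The hopping is dominated by the potential uniformly in $N$: each row sum of weights
is at most $2MV$ (`sum_weight_le_potential`), so by a Schur test $\frac1{2\Delta}A\le\frac M\Delta
V$ as forms.

Let $S$ be multiplication by $-1$ on droplets and by $1$ elsewhere. In the real part of $\langle
S(H-E)f,f\rangle$ the hopping between droplets and other configurations cancels, and there is none
among droplets. What remains is at least $E-M^2$ on droplets and $(1-M/\Delta)(M^2+1)-E$ elsewhere.
Inside the gap $S(H-E)$ is therefore coercive, and $H-E$ has an inverse bounded by the reciprocal of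
the distance from $E$ to the endpoints (`exists_resolvent`). This bound does not depend on $N$, so
the resolvents assemble to one of the direct sum.

Spectrum on both sides of the gap comes from expectations in basis vectors, which equal the
potential: $M^2$ for one block of $k$ full sites, $kM^2$ for $k$ separated full sites. -/

theorem hasFiniteSupport_of_local (m : Config M N) {F : ℤ → ℝ}
    (hF : ∀ x, m x = 0 → m (x + 1) = 0 → F x = 0) : F.HasFiniteSupport := by
  classical
  refine (m.1.support ∪ m.1.support.image (fun x => x - 1)).finite_toSet.subset fun x hx => ?_
  by_contra h
  simp only [Finset.coe_union, Finset.coe_image, Set.mem_union, Finset.mem_coe,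
    Finsupp.mem_support_iff, Set.mem_image, not_or, not_not, not_exists, not_and] at h
  refine hx (hF x h.1 ?_)
  by_contra h'
  exact h.2 (x + 1) h' (by ring)

theorem finsum_shift (m : Config M N) (g : ℤ → ℝ) :
    ∑ᶠ x, g x * (m (x + 1) : ℝ) = ∑ᶠ x, g (x - 1) * (m x : ℝ) := by
  rw [← finsum_comp_equiv (Equiv.addRight (1 : ℤ)) (f := fun x => g (x - 1) * (m x : ℝ))]
  simp

theorem hasFiniteSupport_mul (m : Config M N) (g : ℤ → ℝ) :
    (fun x => g x * (m x : ℝ)).HasFiniteSupport :=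
  hasFiniteSupport_of_local m fun x h _ => by simp [h]

theorem hasFiniteSupport_mul_shift (m : Config M N) (g : ℤ → ℝ) :
    (fun x => g x * (m (x + 1) : ℝ)).HasFiniteSupport :=
  hasFiniteSupport_of_local m fun x _ h => by simp [h]

theorem finsum_mul_diff (m : Config M N) (g : ℤ → ℝ) :
    ∑ᶠ x, (g x * (m (x + 1) : ℝ) - g x * (m x : ℝ)) = ∑ᶠ x, (g (x - 1) - g x) * (m x : ℝ) := by
  rw [finsum_sub_distrib (hasFiniteSupport_mul_shift m g) (hasFiniteSupport_mul m g),
    finsum_shift, ← finsum_sub_distrib (hasFiniteSupport_mul m fun x => g (x - 1))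
      (hasFiniteSupport_mul m g)]
  exact finsum_congr fun x => by ring

theorem finsum_eq_card (m : Config M N) : ∑ᶠ x, (m x : ℝ) = N := by
  have h := m.2.2
  rw [Finsupp.sum] at h
  rw [finsum_eq_sum_of_support_subset (s := m.1.support) _ fun x hx => by simpa using hx]
  exact_mod_cast h

/-- Summation by parts in the potential. -/
theorem potential_eq_add (m : Config M N) (g : ℤ → ℝ) :
    potential m =
      ∑ᶠ x, (pairPotential M (m x) (m (x + 1)) - (g x * (m (x + 1) : ℝ) - g x * (m x : ℝ))) +
        ∑ᶠ x, (g (x - 1) - g x) * (m x : ℝ) := by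
  rw [← finsum_mul_diff, ← finsum_add_distrib
    (hasFiniteSupport_of_local m fun x h h' => by simp [h, h', pairPotential])
    (hasFiniteSupport_of_local m fun x h h' => by simp [h, h'])]
  exact finsum_congr fun x => by ring

/-- A constant `g` contributes nothing globally but turns each edge term into the one-sided product,
which has integer values and matches the weights of moves to the right. -/
theorem potential_eq_right (m : Config M N) :
    potential m = ∑ᶠ x, (m x : ℝ) * (M - m (x + 1)) := by
  rw [potential_eq_add m fun _ => (M : ℝ) / 2]
  simp only [sub_self, zero_mul, finsum_zero, add_zero]
  exact finsum_congr fun x => by rw [pairPotential]; ring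

theorem potential_eq_left (m : Config M N) :
    potential m = ∑ᶠ x, (m x : ℝ) * (M - m (x - 1)) := by
  rw [potential_eq_add m fun _ => -(M : ℝ) / 2]
  simp only [sub_self, zero_mul, finsum_zero, add_zero]
  rw [← finsum_comp_equiv (Equiv.addRight (1 : ℤ)) (f := fun x => (m x : ℝ) * (M - m (x - 1)))]
  refine finsum_congr fun x => ?_
  simp only [Equiv.coe_addRight, add_sub_cancel_right]
  rw [pairPotential]
  ring

theorem finsum_jump (m : Config M N) (x₀ : ℤ) (c d : ℝ) :
    ∑ᶠ x, ((if x - 1 < x₀ then c else d) - (if x < x₀ then c else d)) * (m x : ℝ) =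
      (c - d) * m x₀ := by
  rw [finsum_eq_single _ x₀]
  · simp
  · intro x hx
    rcases lt_or_gt_of_ne hx with h | h
    · simp [h, show x - 1 < x₀ by omega]
    · simp [show ¬ x < x₀ by omega, show ¬ x - 1 < x₀ by omega]

/-- The potential as the cost of a peak at `x₀` plus the cost of the deviation from a
two-sided sharp profile around `x₀`. -/
theorem potential_eq_peak (m : Config M N) (x₀ : ℤ) :
    potential m = ∑ᶠ x, (if x < x₀ then (m x : ℝ) * (M - m (x + 1))
      else (m (x + 1) : ℝ) * (M - m x)) + M * m x₀ := by
  -- The jump of `g` from $M/2$ to $-M/2$ produces the peak term $M\,\mathfrak m(x_0)$.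
  rw [potential_eq_add m fun x => if x < x₀ then (M : ℝ) / 2 else -(M / 2), finsum_jump]
  congr 1
  · refine finsum_congr fun x => ?_
    split_ifs <;> rw [pairPotential] <;> ring
  · ring

/-- Every site other than `x₀` is matched with its edge pointing towards `x₀`, so only the particles
at `x₀` are missed. -/
theorem finsum_off_peak (m : Config M N) (x₀ : ℤ) :
    ∑ᶠ x, (if x < x₀ then (m x : ℝ) else (m (x + 1) : ℝ)) = N - m x₀ := by
  have h := finsum_mul_diff m fun x => if x < x₀ then (0 : ℝ) else 1
  rw [finsum_jump] at h
  rw [← finsum_eq_card m, sub_eq_add_neg, show -(m x₀ : ℝ) = (0 - 1) * m x₀ by ring, ← h,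
    ← finsum_add_distrib (hasFiniteSupport_of_local m fun x h h' => by simp [h])
    (hasFiniteSupport_of_local m fun x h h' => by simp [h, h'])]
  refine finsum_congr fun x => ?_
  split_ifs <;> ring

theorem exists_potential_eq_int (m : Config M N) : ∃ z : ℤ, potential m = z := by
  rw [potential_eq_right]
  refine finsum_induction (p := fun r : ℝ => ∃ z : ℤ, r = z) ⟨0, by simp⟩ ?_ fun x => ?_
  · rintro _ _ ⟨a, rfl⟩ ⟨b, rfl⟩
    exact ⟨a + b, by push_cast; ring⟩
  · exact ⟨(m x : ℤ) * ((M : ℤ) - m (x + 1)), by push_cast; ring⟩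

theorem add_one_le_potential (m : Config M N) (h : ¬ potential m ≤ (M : ℝ) ^ 2) :
    (M : ℝ) ^ 2 + 1 ≤ potential m := by
  obtain ⟨z, hz⟩ := exists_potential_eq_int m
  rw [hz] at h ⊢
  have h' : (M : ℤ) ^ 2 < z := by
    rw [not_le] at h
    exact_mod_cast h
  exact_mod_cast h'

theorem exists_isMax (m : Config M N) : ∃ x₀, ∀ x, m x ≤ m x₀ := by
  rcases m.1.support.eq_empty_or_nonempty with h | h
  · have h0 : ∀ x, m x = 0 := by simpa [Finset.eq_empty_iff_forall_notMem] using h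
    exact ⟨0, fun x => by simp [h0]⟩
  · obtain ⟨x₀, -, hx⟩ := m.1.support.exists_max_image m.1 h
    refine ⟨x₀, fun x => ?_⟩
    by_cases h : x ∈ m.1.support
    · exact hx x h
    · simp [Finsupp.notMem_support_iff.1 h]

/-- A configuration of minimal potential is a droplet: around some full site it is sharp on
both sides. -/
theorem exists_peak (hN : 2 * M ≤ N) (m : Config M N) (hm : potential m ≤ (M : ℝ) ^ 2) :
    ∃ x₀, m x₀ = M ∧ (∀ x < x₀, m x = 0 ∨ m (x + 1) = M) ∧
      ∀ x, x₀ ≤ x → m (x + 1) = 0 ∨ m x = M := by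
  obtain ⟨x₀, hmax⟩ := exists_isMax m
  have hle : ∀ x, (m x : ℝ) ≤ M := fun x => by exact_mod_cast m.2.1 x
  have hmax' : ∀ x, (m x : ℝ) ≤ m x₀ := fun x => by exact_mod_cast hmax x
  have hN' : 2 * (M : ℝ) ≤ N := by exact_mod_cast hN
  set F : ℤ → ℝ := fun x => if x < x₀ then (m x : ℝ) * (M - m (x + 1))
      else (m (x + 1) : ℝ) * (M - m x) with hF
  have hFf : F.HasFiniteSupport :=
    hasFiniteSupport_of_local m fun x h h' => by simp [hF, h, h']
  have hF0 : ∀ x, 0 ≤ F x := fun x => by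
    simp only [hF]
    split_ifs <;> exact mul_nonneg (Nat.cast_nonneg _) (sub_nonneg.2 (hle _))
  have hV : potential m = ∑ᶠ x, F x + M * m x₀ := potential_eq_peak m x₀
  have hp : m x₀ = M := by
    -- Since `x₀` is a maximum, each factor $M-\mathfrak m$ in `F` is at least $M-\mathfrak m(x_0)$.
    have h1 : ((N : ℝ) - m x₀) * (M - m x₀) ≤ ∑ᶠ x, F x := by
      rw [← finsum_off_peak m x₀, finsum_mul]
      refine finsum_le_finsum' ?_ hFf fun x => ?_
      · exact hasFiniteSupport_of_local m fun x h h' => by simp [h, h']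
      · simp only [hF]
        split_ifs
        · exact mul_le_mul_of_nonneg_left (by linarith [hmax' (x + 1)]) (Nat.cast_nonneg _)
        · exact mul_le_mul_of_nonneg_left (by linarith [hmax' x]) (Nat.cast_nonneg _)
    -- With $p=\mathfrak m(x_0)$ and $N\ge 2M$: $M^2\ge V\ge(2M-p)(M-p)+Mp=M^2+(M-p)^2$.
    have h2 : ((M : ℝ) - m x₀) ^ 2 ≤ 0 := by
      nlinarith [mul_nonneg (sub_nonneg.2 hN') (sub_nonneg.2 (hle x₀))]
    have h3 : (M : ℝ) - m x₀ = 0 := by nlinarith [sq_nonneg ((M : ℝ) - m x₀)]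
    exact_mod_cast (sub_eq_zero.1 h3).symm
  -- The peak term alone is now $M^2$, which leaves no budget for any edge.
  have hz : ∀ x, F x = 0 := fun x => by
    refine le_antisymm ?_ (hF0 x)
    refine (single_le_finsum x hFf hF0).trans ?_
    rw [hp] at hV
    nlinarith
  refine ⟨x₀, hp, fun x hx => ?_, fun x hx => ?_⟩
  · have := hz x
    simp only [hF, hx, if_true, mul_eq_zero, Nat.cast_eq_zero, sub_eq_zero] at this
    exact this.imp_right fun h => by exact_mod_cast h.symm
  · have := hz x
    simp only [hF, not_lt.2 hx, if_false, mul_eq_zero, Nat.cast_eq_zero, sub_eq_zero] at this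
    exact this.imp_right fun h => by exact_mod_cast h.symm

theorem not_hop_right (hM : 2 ≤ M) (hN : 2 * M ≤ N) (m n : Config M N)
    (hm : potential m ≤ (M : ℝ) ^ 2) (hn : potential n ≤ (M : ℝ) ^ 2) (x : ℤ)
    (h1 : m x = n x + 1) (h2 : n (x + 1) = m (x + 1) + 1)
    (h3 : ∀ z, z ≠ x → z ≠ x + 1 → m z = n z) : False := by
  obtain ⟨x₀, hx₀, ml, mr⟩ := exists_peak hN m hm
  obtain ⟨x₁, hx₁, nl, nr⟩ := exists_peak hN n hn
  have b1 := m.2.1 x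
  have b2 := n.2.1 (x + 1)
  -- The site `x` is occupied and `x + 1` is not full in `m`, so the edge lies right of the peak of
  -- `m`; likewise it lies left of the peak of `n`.
  have e1 : x₀ ≤ x := by
    by_contra h
    rcases ml x (by omega) with h | h <;> omega
  have e2 : x < x₁ := by
    by_contra h
    rcases nr x (by omega) with h | h <;> omega
  have c1 := mr x e1
  have c2 := nl x e2
  -- The two mixed cases force $M=1$.
  have hcases : (m (x + 1) = 0 ∧ n x = 0) ∨ (m x = M ∧ n (x + 1) = M) := by omega
  rcases hcases with ⟨a, b⟩ | ⟨a, b⟩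
  -- A single particle at the edge detaches: sharpness of `m` makes `x - 1` full, sharpness of `n`
  -- makes it empty.
  · have e3 : x₀ ≠ x := by
      rintro rfl
      omega
    have c3 := mr (x - 1) (by omega)
    rw [sub_add_cancel] at c3
    have c4 := nl (x - 1) (by omega)
    rw [sub_add_cancel] at c4
    have c5 := h3 (x - 1) (by omega) (by omega)
    omega
  -- Here `m` has $M$ and $M-1$ particles at `x` and `x + 1`. Sharpness empties all sites to the
  -- right (through `m`) and to the left (through `n`), giving only $2M-1<N$ particles.
  · have up : ∀ k : ℕ, m (x + 2 + k) = 0 := by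
      intro k
      induction k with
      | zero =>
        have := mr (x + 1) (by omega)
        rw [show x + 1 + 1 = x + 2 + (0 : ℕ) by push_cast; ring] at this
        omega
      | succ k ih =>
        have := mr (x + 2 + k) (by omega)
        rw [show x + 2 + (k : ℤ) + 1 = x + 2 + (k + 1 : ℕ) by push_cast; ring] at this
        omega
    have down : ∀ k : ℕ, n (x - 1 - k) = 0 := by
      intro k
      induction k with
      | zero =>
        have := nl (x - 1) (by omega)
        rw [sub_add_cancel] at this
        simp only [Nat.cast_zero, sub_zero]
        omega
      | succ k ih =>
        have := nl (x - 1 - (k + 1 : ℕ)) (by omega)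
        rw [show x - 1 - ((k + 1 : ℕ) : ℤ) + 1 = x - 1 - (k : ℕ) by push_cast; ring] at this
        omega
    have hs : m.1.support ⊆ {x, x + 1} := by
      intro z hz
      rw [Finsupp.mem_support_iff] at hz
      rw [Finset.mem_insert, Finset.mem_singleton]
      by_contra hzx
      push Not at hzx
      apply hz
      rcases lt_or_ge z x with h | h
      · have := down (x - 1 - z).toNat
        rw [Int.toNat_of_nonneg (by omega), show x - 1 - (x - 1 - z) = z by ring] at this
        exact (h3 z hzx.1 hzx.2).trans this
      · have := up (z - x - 2).toNat
        rwa [Int.toNat_of_nonneg (by omega), show x + 2 + (z - x - 2) = z by ring] at this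
    have hN' := m.2.2
    rw [Finsupp.sum_of_support_subset _ hs _ (by simp), Finset.sum_pair (by omega)] at hN'
    omega

theorem not_hop_of_potential_le (hM : 2 ≤ M) (hN : 2 * M ≤ N) {m n : Config M N}
    (hm : potential m ≤ (M : ℝ) ^ 2) (hn : potential n ≤ (M : ℝ) ^ 2) : ¬ Hop m n := by
  rintro ⟨x, y, hxy, h1, h2, h3⟩
  rcases (abs_eq (by norm_num : (0 : ℤ) ≤ 1)).1 hxy with h | h
  · obtain rfl : x = y + 1 := by omega
    exact not_hop_right hM hN n m hn hm y h2 h1 fun z hy hx => (h3 z hx hy).symm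
  · obtain rfl : y = x + 1 := by omega
    exact not_hop_right hM hN m n hm hn x h1 h2 h3

end Potential

/-! ### Domination of the hopping by the potential. -/

section RowSum

variable {M N : ℕ}

/-- The squared weight is $(M-s)(t+1)\cdot k$ with $k=\mathfrak m(x)(M-\mathfrak m(y))$,
$s=\mathfrak n(x)$, $t=\mathfrak m(y)$. The first product is at most $M^2$, and $k\le k^2$ because
$k\ge1$. -/
theorem weight_le_of_move {m n : Config M N} {x y : ℤ} (hxy : x ≠ y) (h1 : m x = n x + 1)
    (h2 : n y = m y + 1) (h3 : ∀ z, z ≠ x → z ≠ y → m z = n z) :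
    weight m n ≤ M * ((m x : ℝ) * (M - m y)) := by
  have hne : m.1.neLocus n.1 = {x, y} := by
    ext z
    rw [Finsupp.mem_neLocus, Finset.mem_insert, Finset.mem_singleton]
    constructor
    · intro h
      by_contra h'
      push Not at h'
      exact h (h3 z h'.1 h'.2)
    · rintro (rfl | rfl) <;> omega
  rw [weight, hne, Finset.prod_pair hxy]
  have b1 : (n x : ℝ) + 1 ≤ M := by
    have := m.2.1 x
    rw [h1] at this
    exact_mod_cast this
  have b2 : (m y : ℝ) + 1 ≤ M := by
    have := n.2.1 y
    rw [h2] at this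
    exact_mod_cast this
  have e1 : (m x : ℝ) = n x + 1 := by exact_mod_cast h1
  have e2 : (n y : ℝ) = m y + 1 := by exact_mod_cast h2
  rw [e1, e2]
  set s : ℝ := (n x : ℝ)
  set t : ℝ := (m y : ℝ)
  have hs : 0 ≤ s := Nat.cast_nonneg _
  have ht : 0 ≤ t := Nat.cast_nonneg _
  have hM : (0 : ℝ) ≤ M := Nat.cast_nonneg _
  have f1 : (M : ℝ) / 2 * (s + 1 + s + 1) - (s + 1) * s = (s + 1) * (M - s) := by ring
  have f2 : (M : ℝ) / 2 * (t + (t + 1) + 1) - t * (t + 1) = (t + 1) * (M - t) := by ring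
  rw [f1, f2, ← Real.sqrt_mul (mul_nonneg (by linarith) (by linarith))]
  have hk : 1 ≤ (s + 1) * (M - t) := by nlinarith
  rw [Real.sqrt_le_left (mul_nonneg hM (by linarith))]
  have g1 : (M - s) * (t + 1) ≤ M * M :=
    mul_le_mul (by linarith) b2 (by linarith) hM
  calc (s + 1) * (M - s) * ((t + 1) * (M - t))
      = ((M - s) * (t + 1)) * ((s + 1) * (M - t)) := by ring
    _ ≤ (M * M) * ((s + 1) * (M - t)) := mul_le_mul_of_nonneg_right g1 (by linarith)
    _ ≤ (M * M) * (((s + 1) * (M - t)) * ((s + 1) * (M - t))) :=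
        mul_le_mul_of_nonneg_left (by nlinarith) (by positivity)
    _ = _ := by ring

/-- The target site of a particle at `p.1` moving right or left according to `p.2`. -/
def target (p : ℤ × Bool) : ℤ := if p.2 then p.1 + 1 else p.1 - 1

theorem target_ne (p : ℤ × Bool) : p.1 ≠ target p := by
  unfold target
  split_ifs <;> omega

theorem exists_move {m n : Config M N} (h : Hop m n) : ∃ p : ℤ × Bool,
    m p.1 = n p.1 + 1 ∧ n (target p) = m (target p) + 1 ∧
      ∀ z, z ≠ p.1 → z ≠ target p → m z = n z := by
  obtain ⟨x, y, hxy, h1, h2, h3⟩ := h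
  rcases (abs_eq (by norm_num : (0 : ℤ) ≤ 1)).1 hxy with h | h
  · obtain rfl : y = x - 1 := by omega
    exact ⟨(x, false), h1, by simpa [target] using h2, by simpa [target] using h3⟩
  · obtain rfl : y = x + 1 := by omega
    exact ⟨(x, true), h1, by simpa [target] using h2, by simpa [target] using h3⟩

/-- Moves to the right add up to at most $M$ times the potential in its right-sided form, moves to
the left likewise in its left-sided form. The constant does not depend on $N$. -/
theorem sum_weight_le_potential (m : Config M N) :
    ∑ n ∈ neighbors m, weight m n ≤ 2 * M * potential m := by
  classical
  choose! c c1 c2 c3 using fun n (h : n ∈ neighbors m) => exists_move (mem_neighbors.1 h)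
  have hinj : Set.InjOn c (neighbors m) := by
    intro n hn n' hn' h
    have a1 := c1 n hn
    have a2 := c2 n hn
    have a3 := c3 n hn
    have b1 := c1 n' hn'
    have b2 := c2 n' hn'
    have b3 := c3 n' hn'
    rw [← h] at b1 b2 b3
    refine Config.ext' fun z => ?_
    by_cases hz : z = (c n).1
    · subst hz
      omega
    · by_cases hz' : z = target (c n)
      · rw [hz']
        omega
      · rw [← a3 z hz hz', ← b3 z hz hz']
  have hle : ∀ x, (m x : ℝ) ≤ M := fun x => by exact_mod_cast m.2.1 x
  set F : ℤ × Bool → ℝ := fun p => M * ((m p.1 : ℝ) * (M - m (target p))) with hF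
  have hF0 : ∀ p, 0 ≤ F p := fun p =>
    mul_nonneg (Nat.cast_nonneg _) (mul_nonneg (Nat.cast_nonneg _) (sub_nonneg.2 (hle _)))
  have hsub : (neighbors m).image c ⊆ m.1.support ×ˢ (Finset.univ : Finset Bool) := by
    intro p hp
    obtain ⟨n, hn, rfl⟩ := Finset.mem_image.1 hp
    have := c1 n hn
    simp only [Finset.mem_product, Finsupp.mem_support_iff, Finset.mem_univ, and_true]
    omega
  have hfin : ∀ g : ℤ → ℝ, ∑ᶠ x, (m x : ℝ) * g x = ∑ x ∈ m.1.support, (m x : ℝ) * g x :=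
    fun g => finsum_eq_sum_of_support_subset _ fun x hx => by
      have := left_ne_zero_of_mul (Function.mem_support.1 hx)
      simpa using this
  calc ∑ n ∈ neighbors m, weight m n ≤ ∑ n ∈ neighbors m, F (c n) :=
        Finset.sum_le_sum fun n hn =>
          weight_le_of_move (target_ne _) (c1 n hn) (c2 n hn) (c3 n hn)
    _ = ∑ p ∈ (neighbors m).image c, F p := (Finset.sum_image hinj).symm
    _ ≤ ∑ p ∈ m.1.support ×ˢ (Finset.univ : Finset Bool), F p :=
        Finset.sum_le_sum_of_subset_of_nonneg hsub fun p _ _ => hF0 p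
    _ = M * potential m + M * potential m := by
        nth_rewrite 1 [potential_eq_right]
        rw [potential_eq_left, hfin, hfin, Finset.sum_product, Finset.mul_sum, Finset.mul_sum,
          ← Finset.sum_add_distrib]
        simp [hF, target]
    _ = _ := by ring

/-- The weights of the edges, extended by zero to all pairs of configurations. -/
def edgeWeight (m n : Config M N) : ℝ :=
  open Classical in if n ∈ neighbors m then weight m n else 0

theorem mem_neighbors_comm {m n : Config M N} : n ∈ neighbors m ↔ m ∈ neighbors n := by
  rw [mem_neighbors, mem_neighbors, SimpleGraph.adj_comm]

theorem edgeWeight_comm (m n : Config M N) : edgeWeight m n = edgeWeight n m := by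
  unfold edgeWeight
  by_cases h : n ∈ neighbors m
  · rw [if_pos h, if_pos (mem_neighbors_comm.1 h), weight_comm]
  · rw [if_neg h, if_neg fun h' => h (mem_neighbors_comm.1 h')]

theorem edgeWeight_nonneg (m n : Config M N) : 0 ≤ edgeWeight m n := by
  unfold edgeWeight
  split_ifs
  exacts [weight_nonneg m n, le_rfl]

theorem sum_edgeWeight_le (m : Config M N) (s : Finset (Config M N)) :
    ∑ n ∈ s, edgeWeight m n ≤ 2 * M * potential m := by
  classical
  refine le_trans ?_ (sum_weight_le_potential m)
  unfold edgeWeight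
  rw [← Finset.sum_filter]
  exact Finset.sum_le_sum_of_subset_of_nonneg (fun n hn => (Finset.mem_filter.1 hn).2)
    fun n _ _ => weight_nonneg m n

/-- The weighted adjacency form is dominated by the potential. -/
theorem sum_edgeWeight_mul_le (s : Finset (Config M N)) (a : Config M N → ℝ) :
    ∑ m ∈ s, ∑ n ∈ s, edgeWeight m n * (a m * a n) ≤
      2 * M * ∑ m ∈ s, potential m * a m ^ 2 := by
  have hswap : ∑ m ∈ s, ∑ n ∈ s, edgeWeight m n * a n ^ 2 =
      ∑ m ∈ s, ∑ n ∈ s, edgeWeight m n * a m ^ 2 := by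
    rw [Finset.sum_comm]
    exact Finset.sum_congr rfl fun m _ => Finset.sum_congr rfl fun n _ => by
      rw [edgeWeight_comm]
  -- Schur test: $2a_ma_n\le a_m^2+a_n^2$, then symmetry and the row sum bound.
  calc ∑ m ∈ s, ∑ n ∈ s, edgeWeight m n * (a m * a n)
      ≤ ∑ m ∈ s, ∑ n ∈ s, (edgeWeight m n * a m ^ 2 + edgeWeight m n * a n ^ 2) / 2 :=
        Finset.sum_le_sum fun m _ => Finset.sum_le_sum fun n _ => by
          nlinarith [mul_nonneg (edgeWeight_nonneg m n) (sq_nonneg (a m - a n))]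
    _ = ∑ m ∈ s, ∑ n ∈ s, edgeWeight m n * a m ^ 2 := by
        simp_rw [← Finset.sum_div, Finset.sum_add_distrib]
        rw [hswap]
        ring
    _ ≤ ∑ m ∈ s, 2 * M * potential m * a m ^ 2 :=
        Finset.sum_le_sum fun m _ => by
          rw [← Finset.sum_mul]
          exact mul_le_mul_of_nonneg_right (sum_edgeWeight_le m s) (sq_nonneg _)
    _ = _ := by
        rw [Finset.mul_sum]
        exact Finset.sum_congr rfl fun m _ => by ring

end RowSum

/-! ### Operators of symmetric kernels. -/

section KernelLemmas

variable {ι : Type*} (s : ι → Finset ι) (hs : ∀ i j, j ∈ s i ↔ i ∈ s j)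
  (K : ι → ι → ℝ) (hK : ∀ i j, K i j = K j i) (D : ℝ) (hD0 : 0 ≤ D)
  (hD : ∀ i, ∑ j ∈ s i, |K i j| ≤ D)

theorem kernelOp_apply (f : lp (fun _ : ι => ℂ) 2) (i : ι) :
    kernelOp s hs K hK D hD0 hD f i = ∑ j ∈ s i, (K i j : ℂ) * f j := rfl

theorem norm_kernelOp_le : ‖kernelOp s hs K hK D hD0 hD‖ ≤ D :=
  LinearMap.mkContinuous_norm_le _ hD0 _

/-- Coordinates of the adjoint are inner products with basis vectors, whose images are supported in
the finite set `s i`. -/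
theorem isSelfAdjoint_kernelOp : IsSelfAdjoint (kernelOp s hs K hK D hD0 hD) := by
  classical
  rw [ContinuousLinearMap.isSelfAdjoint_iff']
  refine ContinuousLinearMap.ext fun f => lp.ext (funext fun i => ?_)
  have h1 := lp.inner_single_left (𝕜 := ℂ) (G := fun _ : ι => ℂ) i (1 : ℂ)
    (ContinuousLinearMap.adjoint (kernelOp s hs K hK D hD0 hD) f)
  rw [ContinuousLinearMap.adjoint_inner_right, lp.inner_eq_tsum] at h1
  have h2 : ∀ j, kernelOp s hs K hK D hD0 hD (lp.single 2 i (1 : ℂ)) j =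
      if i ∈ s j then (K j i : ℂ) else 0 := by
    intro j
    rw [kernelOp_apply]
    simp only [lp.single_apply, Pi.single_apply, mul_ite, mul_one, mul_zero]
    exact Finset.sum_ite_eq' _ _ _
  rw [tsum_eq_sum (s := s i)] at h1
  · simp only [RCLike.inner_apply, map_one, mul_one] at h1
    rw [← h1, kernelOp_apply]
    refine Finset.sum_congr rfl fun j hj => ?_
    rw [h2, if_pos ((hs i j).1 hj), hK j i, Complex.conj_ofReal, mul_comm]
  · intro j hj
    rw [h2, if_neg fun h => hj ((hs i j).2 h)]
    simp

end KernelLemmas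

/-! ### The sign flip, coercivity and the resolvent in the gap. -/

variable {M N : ℕ}

theorem isSelfAdjoint_hamiltonian (Δ : ℝ) : IsSelfAdjoint (hamiltonian Δ M N) := by
  unfold hamiltonian
  refine IsSelfAdjoint.add (IsSelfAdjoint.smul ?_ (isSelfAdjoint_kernelOp ..))
    (isSelfAdjoint_kernelOp ..)
  exact IsSelfAdjoint.neg (Complex.conj_ofReal _)

/-- The sign `-1` on configurations of minimal potential, `1` on all others. -/
def dropletSign (m : Config M N) : ℝ :=
  open Classical in if potential m ≤ (M : ℝ) ^ 2 then -1 else 1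

theorem dropletSign_eq (m : Config M N) : dropletSign m = -1 ∨ dropletSign m = 1 := by
  unfold dropletSign
  split_ifs <;> simp

/-- Multiplication by the droplet sign. -/
def signOp (M N : ℕ) : NSpace M N →L[ℂ] NSpace M N :=
  kernelOp (fun m => {m}) (fun m n => by simp [eq_comm])
    -- Only the diagonal matters; the average makes the kernel symmetric.
    (fun m n => (dropletSign m + dropletSign n) / 2) (fun m n => by ring)
    1 zero_le_one (fun m => by rcases dropletSign_eq m with h | h <;> simp [h])

theorem signOp_apply (f : NSpace M N) (m : Config M N) :
    signOp M N f m = (dropletSign m : ℂ) * f m := by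
  rw [signOp, kernelOp_apply]
  simp

theorem norm_signOp_le : ‖signOp M N‖ ≤ 1 := norm_kernelOp_le ..

theorem signOp_mul_self : signOp M N * signOp M N = 1 := by
  refine ContinuousLinearMap.ext fun f => lp.ext (funext fun m => ?_)
  change signOp M N (signOp M N f) m = f m
  rw [signOp_apply, signOp_apply]
  rcases dropletSign_eq m with h | h <;> simp [h]

theorem isUnit_signOp : IsUnit (signOp M N) :=
  ⟨⟨_, _, signOp_mul_self, signOp_mul_self⟩, rfl⟩

/-- Edges join droplets only to other configurations, so that after symmetrization of the sign
only edges between configurations of higher potential remain. -/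
theorem sum_dropletSign_mul_le (hM : 2 ≤ M) (hN : 2 * M ≤ N) (s : Finset (Config M N))
    (f : Config M N → ℂ) :
    ∑ m ∈ s, dropletSign m * ∑ n ∈ s, edgeWeight m n * (f m * (starRingEnd ℂ) (f n)).re ≤
      2 * M * ∑ m ∈ s, potential m * ((1 + dropletSign m) / 2 * ‖f m‖) ^ 2 := by
  refine le_trans ?_ (sum_edgeWeight_mul_le s fun m => (1 + dropletSign m) / 2 * ‖f m‖)
  have hR : ∀ m n, (f m * (starRingEnd ℂ) (f n)).re = (f n * (starRingEnd ℂ) (f m)).re := by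
    intro m n
    simp only [Complex.mul_re, Complex.conj_re, Complex.conj_im]
    ring
  have hswap : ∑ m ∈ s, ∑ n ∈ s,
      dropletSign m * (edgeWeight m n * (f m * (starRingEnd ℂ) (f n)).re) =
      ∑ m ∈ s, ∑ n ∈ s,
      dropletSign n * (edgeWeight m n * (f m * (starRingEnd ℂ) (f n)).re) := by
    rw [Finset.sum_comm]
    exact Finset.sum_congr rfl fun m _ => Finset.sum_congr rfl fun n _ => by
      rw [edgeWeight_comm, hR]
  calc ∑ m ∈ s, dropletSign m * ∑ n ∈ s, edgeWeight m n * (f m * (starRingEnd ℂ) (f n)).re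
      = ∑ m ∈ s, ∑ n ∈ s, (dropletSign m + dropletSign n) / 2 *
          (edgeWeight m n * (f m * (starRingEnd ℂ) (f n)).re) := by
        simp_rw [add_div, add_mul, Finset.sum_add_distrib, div_mul_eq_mul_div, ← Finset.sum_div]
        rw [← hswap, add_halves]
        simp_rw [Finset.mul_sum]
    _ ≤ _ := Finset.sum_le_sum fun m _ => Finset.sum_le_sum fun n _ => ?_
  have hre : (f m * (starRingEnd ℂ) (f n)).re ≤ ‖f m‖ * ‖f n‖ := by
    refine (Complex.re_le_norm _).trans (le_of_eq ?_)
    rw [norm_mul, RCLike.norm_conj]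
  by_cases hmn : n ∈ neighbors m
  · have hadj : Hop m n := mem_neighbors.1 hmn
    have hw := mul_le_mul_of_nonneg_left hre (edgeWeight_nonneg m n)
    -- The averaged sign is $0$ on mixed edges, and $(1+\sigma)/2$ is the indicator of the
    -- non-droplets.
    by_cases hm : potential m ≤ (M : ℝ) ^ 2 <;> by_cases hn : potential n ≤ (M : ℝ) ^ 2
    · exact absurd hadj (not_hop_of_potential_le hM hN hm hn)
    · simp [dropletSign, hm, hn]
    · simp [dropletSign, hm, hn]
    · simpa [dropletSign, hm, hn] using hw
  · simp [edgeWeight, hmn]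

/-- Finite support turns the form into finite sums, where the diagonal can be compared with the
dominated hopping configuration by configuration. -/
theorem re_inner_finite_ge (hM : 2 ≤ M) (hN : 2 * M ≤ N) {Δ E c : ℝ} (hΔ : (M : ℝ) ≤ Δ)
    (h1 : c ≤ E - (M : ℝ) ^ 2) (h2 : c ≤ (1 - (M : ℝ) / Δ) * ((M : ℝ) ^ 2 + 1) - E)
    (s : Finset (Config M N)) (f : NSpace M N) (hf : ∀ m, m ∉ s → f m = 0) :
    c * ‖f‖ ^ 2 ≤
      (inner ℂ (signOp M N ((hamiltonian Δ M N - algebraMap ℂ _ (E : ℂ)) f)) f).re := by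
  have hMpos : (0 : ℝ) < M := by
    have : (2 : ℝ) ≤ M := by exact_mod_cast hM
    linarith
  have hΔ0 : 0 < Δ := hMpos.trans_le hΔ
  have hnorm : ‖f‖ ^ 2 = ∑ m ∈ s, ‖f m‖ ^ 2 := by
    have h := lp.norm_rpow_eq_tsum (p := 2) (by simp) f
    rw [tsum_eq_sum (s := s) fun m hm => by simp [hf m hm]] at h
    simpa using h
  have hH : ∀ m, (hamiltonian Δ M N - algebraMap ℂ _ (E : ℂ)) f m =
      -(1 / (2 * (Δ : ℂ))) * ∑ n ∈ s, (edgeWeight m n : ℂ) * f n +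
        ((potential m - E : ℝ) : ℂ) * f m := by
    intro m
    have h : (hamiltonian Δ M N - algebraMap ℂ _ (E : ℂ)) f m =
      hamiltonian Δ M N f m - (E : ℂ) * f m := rfl
    have h' : ∑ n ∈ s, (edgeWeight m n : ℂ) * f n =
        ∑ n ∈ neighbors m, (weight m n : ℂ) * f n := by
      classical
      have e1 : ∀ n, (edgeWeight m n : ℂ) * f n =
          if n ∈ neighbors m then (weight m n : ℂ) * f n else 0 := by
        intro n
        unfold edgeWeight
        split_ifs <;> simp
      simp_rw [e1]
      rw [← Finset.sum_filter]
      refine Finset.sum_subset (fun n hn => (Finset.mem_filter.1 hn).2) fun n hn hn' => ?_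
      have : n ∉ s := fun h => hn' (Finset.mem_filter.2 ⟨h, hn⟩)
      rw [hf n this, mul_zero]
    rw [h, hamiltonian_apply, h']
    push_cast
    ring
  have hterm : ∀ m, (inner ℂ (signOp M N ((hamiltonian Δ M N - algebraMap ℂ _ (E : ℂ)) f) m)
      (f m)).re = dropletSign m * (potential m - E) * ‖f m‖ ^ 2 -
        1 / (2 * Δ) * (dropletSign m *
          ∑ n ∈ s, edgeWeight m n * (f m * (starRingEnd ℂ) (f n)).re) := by
    intro m
    have e : f m * (starRingEnd ℂ) (f m) = ((‖f m‖ ^ 2 : ℝ) : ℂ) := by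
      rw [Complex.mul_conj, Complex.normSq_eq_norm_sq]
    have : inner ℂ (signOp M N ((hamiltonian Δ M N - algebraMap ℂ _ (E : ℂ)) f) m) (f m) =
        ((dropletSign m * (potential m - E) * ‖f m‖ ^ 2 : ℝ) : ℂ) -
        ((1 / (2 * Δ) * dropletSign m : ℝ) : ℂ) *
          ∑ n ∈ s, (edgeWeight m n : ℂ) * (f m * (starRingEnd ℂ) (f n)) := by
      rw [signOp_apply, hH, RCLike.inner_apply]
      simp only [map_mul, map_add, map_sum, map_neg, map_div₀, map_one, map_ofNat,
        Complex.conj_ofReal]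
      have e2 : ∑ n ∈ s, (edgeWeight m n : ℂ) * (f m * (starRingEnd ℂ) (f n)) =
          f m * ∑ n ∈ s, (edgeWeight m n : ℂ) * (starRingEnd ℂ) (f n) := by
        rw [Finset.mul_sum]
        exact Finset.sum_congr rfl fun n _ => by ring
      rw [e2]
      push_cast at e ⊢
      rw [← e]
      ring
    rw [this, Complex.sub_re, Complex.ofReal_re, Complex.re_ofReal_mul, Complex.re_sum]
    simp_rw [Complex.re_ofReal_mul]
    ring
  have hinner : (inner ℂ (signOp M N ((hamiltonian Δ M N - algebraMap ℂ _ (E : ℂ)) f)) f).re =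
      ∑ m ∈ s, dropletSign m * (potential m - E) * ‖f m‖ ^ 2 -
        1 / (2 * Δ) * ∑ m ∈ s, dropletSign m *
          ∑ n ∈ s, edgeWeight m n * (f m * (starRingEnd ℂ) (f n)).re := by
    rw [lp.inner_eq_tsum, tsum_eq_sum (s := s) fun m hm => by rw [hf m hm, inner_zero_right],
      Complex.re_sum, Finset.mul_sum, ← Finset.sum_sub_distrib]
    exact Finset.sum_congr rfl fun m _ => hterm m
  have hoff := mul_le_mul_of_nonneg_left
    (sum_dropletSign_mul_le hM hN s f) (by positivity : 0 ≤ 1 / (2 * Δ))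
  rw [hinner, hnorm]
  refine le_trans ?_ (sub_le_sub_left hoff _)
  rw [← mul_assoc, show 1 / (2 * Δ) * (2 * M) = (M : ℝ) / Δ by field_simp, Finset.mul_sum,
    Finset.mul_sum, ← Finset.sum_sub_distrib]
  refine Finset.sum_le_sum fun m _ => ?_
  -- On a droplet the flipped diagonal is $E-V\ge E-M^2$. Elsewhere hopping costs a fraction
  -- $M/\Delta$ of $V$, and $V\ge M^2+1$.
  by_cases hm : potential m ≤ (M : ℝ) ^ 2
  · simp only [dropletSign, hm, if_true]
    nlinarith [sq_nonneg ‖f m‖]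
  · simp only [dropletSign, hm, if_false]
    have h3 : 0 ≤ 1 - (M : ℝ) / Δ := by
      rw [sub_nonneg, div_le_one hΔ0]
      exact hΔ
    have h4 := mul_le_mul_of_nonneg_left (add_one_le_potential m hm) h3
    have h5 : c ≤ (1 - (M : ℝ) / Δ) * potential m - E := by linarith
    have h6 := mul_le_mul_of_nonneg_right h5 (sq_nonneg ‖f m‖)
    refine h6.trans (le_of_eq ?_)
    ring

/-- Both sides are continuous in `f`, and finite truncations converge to `f`. -/
theorem re_inner_ge (hM : 2 ≤ M) (hN : 2 * M ≤ N) {Δ E c : ℝ} (hΔ : (M : ℝ) ≤ Δ)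
    (h1 : c ≤ E - (M : ℝ) ^ 2) (h2 : c ≤ (1 - (M : ℝ) / Δ) * ((M : ℝ) ^ 2 + 1) - E)
    (f : NSpace M N) :
    c * ‖f‖ ^ 2 ≤
      (inner ℂ (signOp M N ((hamiltonian Δ M N - algebraMap ℂ _ (E : ℂ)) f)) f).re := by
  classical
  have hlim : Filter.Tendsto (fun s : Finset (Config M N) => ∑ m ∈ s, lp.single 2 m (f m))
      Filter.atTop (nhds f) := lp.hasSum_single (by simp) f
  have hc1 : Continuous fun g : NSpace M N => c * ‖g‖ ^ 2 := by fun_prop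
  have hc2 : Continuous fun g : NSpace M N =>
      (inner ℂ (signOp M N ((hamiltonian Δ M N - algebraMap ℂ _ (E : ℂ)) g)) g).re :=
    Complex.continuous_re.comp (Continuous.inner
      ((signOp M N).continuous.comp (ContinuousLinearMap.continuous _)) continuous_id)
  refine le_of_tendsto_of_tendsto' ((hc1.tendsto f).comp hlim) ((hc2.tendsto f).comp hlim)
    fun s => re_inner_finite_ge hM hN hΔ h1 h2 s _ fun m hm => ?_
  rw [lp.coeFn_sum, Finset.sum_apply]
  refine Finset.sum_eq_zero fun n hn => ?_
  exact lp.single_apply_ne 2 n _ fun h => hm (h ▸ hn)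

/-- A real energy between the droplet energy and the first excited level has a resolvent,
bounded independently of the particle number. -/
theorem exists_resolvent (hM : 2 ≤ M) (hN : 2 * M ≤ N) {Δ E c : ℝ} (hΔ : (M : ℝ) ≤ Δ)
    (hc : 0 < c) (h1 : c ≤ E - (M : ℝ) ^ 2)
    (h2 : c ≤ (1 - (M : ℝ) / Δ) * ((M : ℝ) ^ 2 + 1) - E) :
    ∃ R : NSpace M N →L[ℂ] NSpace M N, ‖R‖ ≤ c⁻¹ ∧
      (hamiltonian Δ M N - algebraMap ℂ _ (E : ℂ)) * R = 1 ∧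
      R * (hamiltonian Δ M N - algebraMap ℂ _ (E : ℂ)) = 1 := by
  set T : NSpace M N →L[ℂ] NSpace M N := hamiltonian Δ M N - algebraMap ℂ _ (E : ℂ) with hT
  have hge : ∀ f, c * ‖f‖ ^ 2 ≤ ‖inner ℂ ((signOp M N * T) f) f‖ := fun f =>
    (re_inner_ge hM hN hΔ h1 h2 f).trans (Complex.re_le_norm _)
  -- Lax–Milgram; the sign is then removed because it is an involution.
  have hu : IsUnit (signOp M N * T) :=
    ContinuousLinearMap.isUnit_of_forall_le_norm_inner_map _ (c := ⟨c, hc.le⟩) hc fun f => by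
      rw [mul_comm]
      exact hge f
  have huT : IsUnit T := by
    have := isUnit_signOp.mul hu
    rwa [← mul_assoc, signOp_mul_self, one_mul] at this
  have hbelow : ∀ f, c * ‖f‖ ≤ ‖T f‖ := by
    intro f
    rcases (norm_nonneg f).eq_or_lt with h | h
    · rw [← h, mul_zero]
      exact norm_nonneg _
    · refine le_of_mul_le_mul_right ?_ h
      calc c * ‖f‖ * ‖f‖ = c * ‖f‖ ^ 2 := by ring
        _ ≤ ‖inner ℂ (signOp M N (T f)) f‖ := hge f
        _ ≤ ‖signOp M N (T f)‖ * ‖f‖ := norm_inner_le_norm _ _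
        _ ≤ ‖T f‖ * ‖f‖ := by
            refine mul_le_mul_of_nonneg_right ?_ h.le
            simpa using (signOp M N).le_of_opNorm_le norm_signOp_le (T f)
  obtain ⟨u, hu⟩ := huT
  refine ⟨(u⁻¹ : (NSpace M N →L[ℂ] NSpace M N)ˣ).1, ?_, ?_, ?_⟩
  · refine ContinuousLinearMap.opNorm_le_bound _ (inv_nonneg.2 hc.le) fun g => ?_
    have h := hbelow ((u⁻¹ : (NSpace M N →L[ℂ] NSpace M N)ˣ).1 g)
    have e : T ((u⁻¹ : (NSpace M N →L[ℂ] NSpace M N)ˣ).1 g) = g := by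
      rw [← hu]
      exact congrArg (fun S : NSpace M N →L[ℂ] NSpace M N => S g) u.mul_inv
    rw [e] at h
    rw [inv_mul_eq_div, le_div_iff₀ hc, mul_comm]
    exact h
  · rw [← hu]
    exact u.mul_inv
  · rw [← hu]
    exact u.inv_mul

/-! ### Test configurations on both sides of the gap. -/

/-- The configuration with the sites in `s` fully occupied and all others empty. -/
def fullConfig (M : ℕ) (s : Finset ℤ) (k : ℕ) (hs : s.card = k) : Config M (k * M) :=
  ⟨Finsupp.indicator s fun _ _ => M,
    fun x => by
      rw [Finsupp.indicator_apply]
      split_ifs <;> simp, by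
    rw [Finsupp.sum_of_support_subset _ (Finsupp.support_indicator_subset s _) _ (by simp),
      ← hs, ← smul_eq_mul, ← Finset.sum_const]
    exact Finset.sum_congr rfl fun x hx => by rw [Finsupp.indicator_of_mem hx]⟩

theorem fullConfig_apply (s : Finset ℤ) (k : ℕ) (hs : s.card = k) (x : ℤ) :
    fullConfig M s k hs x = if x ∈ s then M else 0 := by
  change Finsupp.indicator s (fun _ _ => M) x = _
  rw [Finsupp.indicator_apply]
  split_ifs <;> rfl

/-- Each full site with an empty right neighbour costs $M^2$, so the potential counts maximal
blocks. -/
theorem potential_fullConfig (s : Finset ℤ) (k : ℕ) (hs : s.card = k) :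
    potential (fullConfig M s k hs) =
      (s.filter fun x => x + 1 ∉ s).card * (M : ℝ) ^ 2 := by
  rw [potential_eq_right, finsum_eq_sum_of_support_subset (s := s) _ fun x hx => ?_,
    ← nsmul_eq_mul, ← Finset.sum_const, Finset.sum_filter]
  · refine Finset.sum_congr rfl fun x hx => ?_
    rw [fullConfig_apply, fullConfig_apply, if_pos hx]
    split_ifs <;> first | contradiction | (push_cast; ring)
  · by_contra h
    refine hx ?_
    simp only [Finset.mem_coe] at h
    simp [fullConfig_apply, h]

theorem exists_potential_eq_sq {k : ℕ} (hk : 1 ≤ k) :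
    ∃ m : Config M (k * M), potential m = (M : ℝ) ^ 2 := by
  refine ⟨fullConfig M (Finset.Ico 0 (k : ℤ)) k (by simp), ?_⟩
  have h : (Finset.Ico 0 (k : ℤ)).filter (fun x => x + 1 ∉ Finset.Ico 0 (k : ℤ)) =
      {(k : ℤ) - 1} := by
    ext x
    simp only [Finset.mem_filter, Finset.mem_Ico, Finset.mem_singleton]
    omega
  rw [potential_fullConfig, h]
  simp

/-- Full sites placed two apart form $k$ separate blocks; for $k\ge2$ this lies above the gap. -/
theorem exists_potential_eq_mul_sq (k : ℕ) :
    ∃ m : Config M (k * M), potential m = k * (M : ℝ) ^ 2 := by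
  have hinj : Function.Injective fun j : ℕ => 2 * (j : ℤ) := fun a b h => by
    simp only at h
    omega
  refine ⟨fullConfig M ((Finset.range k).image fun j : ℕ => 2 * (j : ℤ)) k
    (by rw [Finset.card_image_of_injective _ hinj, Finset.card_range]), ?_⟩
  rw [potential_fullConfig, Finset.filter_true_of_mem, Finset.card_image_of_injective _ hinj,
    Finset.card_range]
  intro x hx hx'
  obtain ⟨i, -, hi⟩ := Finset.mem_image.1 hx
  obtain ⟨j, -, hj⟩ := Finset.mem_image.1 hx'
  omega

/-- The graph has no loops, so a basis vector sees only the diagonal. -/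
theorem exists_inner_hamiltonian_eq (Δ : ℝ) (m : Config M N) :
    ∃ f : NSpace M N, ‖f‖ = 1 ∧ (inner ℂ (hamiltonian Δ M N f) f).re = potential m := by
  classical
  refine ⟨lp.single 2 m (1 : ℂ), by rw [lp.norm_single (by simp), norm_one], ?_⟩
  have hs : ∑ n ∈ neighbors m, (weight m n : ℂ) *
      (lp.single 2 m (1 : ℂ) : NSpace M N) n = 0 :=
    Finset.sum_eq_zero fun n hn => by
      have hne : n ≠ m := ((mem_neighbors.1 hn).ne).symm
      rw [lp.single_apply_ne 2 m _ hne, mul_zero]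
  rw [lp.inner_single_right, hamiltonian_apply, hs, lp.single_apply_self]
  simp

/-! ### Spectral gaps from expectation values. -/

section SelfAdjoint

variable {H : Type*} [NormedAddCommGroup H] [InnerProductSpace ℂ H] [CompleteSpace H]

theorem le_re_inner_of_spectrum {T : H →L[ℂ] H} (hT : IsSelfAdjoint T) {r : ℝ}
    (h : ∀ x ∈ spectrum ℝ T, r ≤ x) {f : H} (hf : ‖f‖ = 1) : r ≤ (inner ℂ (T f) f).re := by
  have h1 := (ContinuousLinearMap.le_def _ _).1 ((algebraMap_le_iff_le_spectrum hT).2 h)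
  have h2 := h1.re_inner_nonneg_left f
  have h3 : (T - algebraMap ℝ (H →L[ℂ] H) r) f = T f - (r : ℂ) • f := rfl
  rw [h3, inner_sub_left, inner_smul_left, inner_self_eq_norm_sq_to_K, hf] at h2
  simpa using h2

theorem re_inner_le_of_spectrum {T : H →L[ℂ] H} (hT : IsSelfAdjoint T) {r : ℝ}
    (h : ∀ x ∈ spectrum ℝ T, x ≤ r) {f : H} (hf : ‖f‖ = 1) : (inner ℂ (T f) f).re ≤ r := by
  have h1 := (ContinuousLinearMap.le_def _ _).1 ((le_algebraMap_iff_spectrum_le hT).2 h)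
  have h2 := h1.re_inner_nonneg_left f
  have h3 : (algebraMap ℝ (H →L[ℂ] H) r - T) f = (r : ℂ) • f - T f := rfl
  rw [h3, inner_sub_left, inner_smul_left, inner_self_eq_norm_sq_to_K, hf] at h2
  simpa using h2

/-- An interval in the resolvent set of a self-adjoint operator is a spectral gap as soon as
there are expectation values on both sides of it. -/
theorem isSpectralGap_of_isSelfAdjoint {T : H →L[ℂ] H} (hT : IsSelfAdjoint T) {a b : ℝ}
    (hab : a < b) (hgap : ∀ E : ℝ, a < E → E < b → (E : ℂ) ∉ spectrum ℂ T)
    (ha : ∃ f : H, ‖f‖ = 1 ∧ (inner ℂ (T f) f).re ≤ a)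
    (hb : ∃ f : H, ‖f‖ = 1 ∧ b ≤ (inner ℂ (T f) f).re) :
    IsSpectralGap (spectrum ℂ T) a b := by
  have hmem : ∀ x : ℝ, x ∈ spectrum ℝ T ↔ (x : ℂ) ∈ spectrum ℂ T := fun x =>
    (spectrum.algebraMap_mem_iff ℂ).symm
  obtain ⟨f, hf, hfa⟩ := ha
  obtain ⟨g, hg, hgb⟩ := hb
  refine ⟨hab, hgap, ?_, ?_⟩
  -- Without spectrum up to `a`, the gap pushes all spectrum to at least `b`, and every expectation
  -- with it.
  · by_contra! h
    refine absurd ((le_re_inner_of_spectrum hT (r := b) (fun x hx => ?_) hf).trans hfa)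
      (not_le.2 hab)
    by_contra! hxb
    have hx' := (hmem x).1 hx
    exact hgap x (lt_of_not_ge fun hxa => h x hxa hx') hxb hx'
  · by_contra! h
    refine absurd (hgb.trans (re_inner_le_of_spectrum hT (r := a) (fun x hx => ?_) hg))
      (not_le.2 hab)
    by_contra! hxa
    have hx' := (hmem x).1 hx
    exact hgap x hxa (lt_of_not_ge fun hxb => h x hxb hx') hx'

end SelfAdjoint

/-! ### Resolvents and spectra of direct sums. -/

section DirectSum

variable {ι : Type*} {E : ι → Type*} [∀ i, NormedAddCommGroup (E i)] [∀ i, NormedSpace ℂ (E i)]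

/-- Uniformly bounded resolvents of the summands give a resolvent of the direct sum. -/
theorem mem_unboundedResolventSet_directSumOp (T : ∀ i, E i →L[ℂ] E i) (z : ℂ) {K : ℝ}
    (hK : 0 ≤ K) (R : ∀ i, E i →L[ℂ] E i) (hR : ∀ i, ‖R i‖ ≤ K)
    (h1 : ∀ i, (T i - algebraMap ℂ _ z) * R i = 1)
    (h2 : ∀ i, R i * (T i - algebraMap ℂ _ z) = 1) :
    z ∈ unboundedResolventSet (directSumOp T) := by
  have h1' : ∀ i g, T i (R i g) - z • R i g = g := fun i g =>
    congrArg (fun S : E i →L[ℂ] E i => S g) (h1 i)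
  have h2' : ∀ i f, R i (T i f - z • f) = f := fun i f =>
    congrArg (fun S : E i →L[ℂ] E i => S f) (h2 i)
  refine ⟨lp.mapCLM 2 R hK hR, fun g => ?_, fun f => ?_⟩
  · have hdom : lp.mapCLM 2 R hK hR g ∈ (directSumOp T).domain := by
      change Memℓp (fun i => T i (lp.mapCLM 2 R hK hR g i)) 2
      -- Since $TRg=g+zRg$ is square summable, $Rg$ lies in the domain.
      have e : (fun i => T i (lp.mapCLM 2 R hK hR g i)) =
          ⇑(g + z • lp.mapCLM 2 R hK hR g) := by
        funext i
        have := h1' i (g i)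
        rw [sub_eq_iff_eq_add] at this
        rw [lp.mapCLM_apply_coe, this, lp.coeFn_add, lp.coeFn_smul, Pi.add_apply, Pi.smul_apply,
          lp.mapCLM_apply_coe]
      rw [e]
      exact lp.memℓp _
    refine ⟨hdom, lp.ext (funext fun i => ?_)⟩
    rw [lp.coeFn_sub, lp.coeFn_smul, Pi.sub_apply, Pi.smul_apply]
    change T i (lp.mapCLM 2 R hK hR g i) - z • lp.mapCLM 2 R hK hR g i = g i
    rw [lp.mapCLM_apply_coe]
    exact h1' i (g i)
  · refine lp.ext (funext fun i => ?_)
    rw [lp.mapCLM_apply_coe, lp.coeFn_sub, lp.coeFn_smul, Pi.sub_apply, Pi.smul_apply]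
    exact h2' i (f.1 i)

/-- The spectrum of a summand is contained in the spectrum of the direct sum. -/
theorem spectrum_subset_unboundedSpectrum_directSumOp (T : ∀ i, E i →L[ℂ] E i) (i : ι) :
    spectrum ℂ (T i) ⊆ unboundedSpectrum (directSumOp T) := by
  classical
  rintro z hz ⟨R, hR1, hR2⟩
  refine hz ?_
  have hdom : ∀ f : E i, lp.single 2 i f ∈ (directSumOp T).domain := by
    intro f
    change Memℓp (fun j => T j (lp.single 2 i f j)) 2
    have e : (fun j => T j (lp.single 2 i f j)) = ⇑(lp.single 2 i (T i f)) := by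
      funext j
      by_cases h : j = i
      · subst h
        rw [lp.single_apply_self, lp.single_apply_self]
      · rw [lp.single_apply_ne 2 i _ h, lp.single_apply_ne 2 i _ h, map_zero]
    rw [e]
    exact lp.memℓp _
  -- The compression of the resolvent to the `i`-th summand inverts $T_i-z$.
  set S : E i →L[ℂ] E i := (lp.evalCLM ℂ E 2 i).comp
    (R.comp (lp.singleContinuousLinearMap ℂ E 2 i)) with hS
  have hSa : ∀ g, S g = R (lp.single 2 i g) i := fun g => rfl
  have e1 : (T i - algebraMap ℂ _ z) * S = 1 := by
    refine ContinuousLinearMap.ext fun g => ?_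
    obtain ⟨h, hg⟩ := hR1 (lp.single 2 i g)
    have := congrArg (fun f : lp E 2 => f i) hg
    simp only [lp.coeFn_sub, lp.coeFn_smul, Pi.sub_apply, Pi.smul_apply,
      lp.single_apply_self] at this
    exact this
  have e2 : S * (T i - algebraMap ℂ _ z) = 1 := by
    refine ContinuousLinearMap.ext fun f => ?_
    have h := hR2 ⟨lp.single 2 i f, hdom f⟩
    have e : directSumOp T ⟨lp.single 2 i f, hdom f⟩ - z • lp.single 2 i f =
        lp.single 2 i (T i f - z • f) := by
      refine lp.ext (funext fun j => ?_)
      rw [lp.coeFn_sub, lp.coeFn_smul, Pi.sub_apply, Pi.smul_apply]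
      change T j (lp.single 2 i f j) - z • lp.single 2 i f j = _
      by_cases h : j = i
      · subst h
        rw [lp.single_apply_self, lp.single_apply_self]
      · rw [lp.single_apply_ne 2 i _ h, lp.single_apply_ne 2 i _ h, map_zero, smul_zero,
          sub_zero]
    rw [e] at h
    have := congrArg (fun f : lp E 2 => f i) h
    simp only [lp.single_apply_self] at this
    exact this
  have hu : IsUnit (T i - algebraMap ℂ _ z) := ⟨⟨_, S, e1, e2⟩, rfl⟩
  change IsUnit _
  rw [← neg_sub]
  exact hu.neg

end DirectSum

/-! ### Assembling the gap. -/

theorem isSpectralGap_hamiltonian (hM : 2 ≤ M) {Δ : ℝ} (hΔ : (M : ℝ) ≤ Δ)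
    (hab : (M : ℝ) ^ 2 < (1 - (M : ℝ) / Δ) * ((M : ℝ) ^ 2 + 1)) {k : ℕ} (hk : 2 ≤ k) :
    IsSpectralGap (spectrum ℂ (hamiltonian Δ M (k * M))) ((M : ℝ) ^ 2)
      ((1 - (M : ℝ) / Δ) * ((M : ℝ) ^ 2 + 1)) := by
  refine isSpectralGap_of_isSelfAdjoint (isSelfAdjoint_hamiltonian Δ) hab (fun E h1 h2 => ?_)
    ?_ ?_
  · obtain ⟨R, -, e1, e2⟩ := exists_resolvent (N := k * M) hM (Nat.mul_le_mul_right M hk) hΔ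
      (lt_min (sub_pos.2 h1) (sub_pos.2 h2)) (min_le_left _ _) (min_le_right _ _)
    rw [spectrum.notMem_iff, ← neg_sub]
    exact IsUnit.neg ⟨⟨_, R, e1, e2⟩, rfl⟩
  · obtain ⟨m, hm⟩ := exists_potential_eq_sq (M := M) (by omega : 1 ≤ k)
    obtain ⟨f, hf, hf'⟩ := exists_inner_hamiltonian_eq Δ m
    exact ⟨f, hf, (hf'.trans hm).le⟩
  · obtain ⟨m, hm⟩ := exists_potential_eq_mul_sq (M := M) k
    obtain ⟨f, hf, hf'⟩ := exists_inner_hamiltonian_eq Δ m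
    refine ⟨f, hf, ?_⟩
    rw [hf', hm]
    have hM' : (2 : ℝ) ≤ M := by exact_mod_cast hM
    have hk' : (2 : ℝ) ≤ k := by exact_mod_cast hk
    have h0 : 0 ≤ (M : ℝ) / Δ := div_nonneg (by linarith) (by linarith)
    calc (1 - (M : ℝ) / Δ) * ((M : ℝ) ^ 2 + 1) ≤ 1 * ((M : ℝ) ^ 2 + 1) :=
          mul_le_mul_of_nonneg_right (by linarith) (by positivity)
      _ ≤ 2 * (M : ℝ) ^ 2 := by nlinarith
      _ ≤ k * (M : ℝ) ^ 2 := mul_le_mul_of_nonneg_right hk' (by positivity)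

theorem isSpectralGap_restrictedHamiltonian (hM : 2 ≤ M) {Δ : ℝ} (hΔ : (M : ℝ) ≤ Δ)
    (hab : (M : ℝ) ^ 2 < (1 - (M : ℝ) / Δ) * ((M : ℝ) ^ 2 + 1)) :
    IsSpectralGap (unboundedSpectrum (restrictedHamiltonian Δ M)) ((M : ℝ) ^ 2)
      ((1 - (M : ℝ) / Δ) * ((M : ℝ) ^ 2 + 1)) := by
  have hsub : spectrum ℂ (hamiltonian Δ M (2 * M)) ⊆
      unboundedSpectrum (restrictedHamiltonian Δ M) :=
    spectrum_subset_unboundedSpectrum_directSumOp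
      (fun k : Set.Ici (2 : ℕ) => hamiltonian Δ M (k * M)) ⟨2, Set.mem_Ici.2 le_rfl⟩
  obtain ⟨-, -, ⟨E₁, h1, h1'⟩, ⟨E₂, h2, h2'⟩⟩ := isSpectralGap_hamiltonian hM hΔ hab le_rfl
  refine ⟨hab, fun E ha hb hE => hE ?_, ⟨E₁, h1, hsub h1'⟩, ⟨E₂, h2, hsub h2'⟩⟩
  -- This constant does not involve `k`, so the resolvents of all summands share one bound.
  have hc := lt_min (sub_pos.2 ha) (sub_pos.2 hb)
  choose R hR e1 e2 using fun k : Set.Ici (2 : ℕ) =>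
    exists_resolvent (N := k * M) hM (Nat.mul_le_mul_right M k.2) hΔ hc
      (min_le_left _ _) (min_le_right _ _)
  exact mem_unboundedResolventSet_directSumOp _ _ (inv_nonneg.2 hc.le) R hR e1 e2

end

end XXZChain

theorem mainTheorem3 (M : ℕ) (hM : 2 ≤ M) :
    ∃ C : ℝ, ∀ Δ : ℝ, (M : ℝ) ^ 3 + 2 * (M : ℝ) ^ (3 / 2 : ℝ) + (M : ℝ) < Δ →
      ∃ a b : ℝ,
        (M : ℝ) ^ 2 ≤ a ∧ a ≤ (M : ℝ) ^ 2 + C / Δ ^ 2 ∧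
        (1 - (M : ℝ) / Δ) * ((M : ℝ) ^ 2 + 1) - C / Δ ^ 2 ≤ b ∧
        b ≤ (1 - (M : ℝ) / Δ) * ((M : ℝ) ^ 2 + 1) ∧
        (∀ k : ℕ, 2 ≤ k →
          XXZChain.IsSpectralGap (spectrum ℂ (XXZChain.hamiltonian Δ M (k * M))) a b) ∧
        XXZChain.IsSpectralGap
          (XXZChain.unboundedSpectrum (XXZChain.restrictedHamiltonian Δ M)) a b := by
  refine ⟨0, fun Δ h => ?_⟩
  have hM' : (2 : ℝ) ≤ M := by exact_mod_cast hM
  have hr : 0 ≤ (M : ℝ) ^ (3 / 2 : ℝ) := by positivity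
  have hM3 : 0 ≤ (M : ℝ) ^ 3 := by positivity
  have hΔ : (M : ℝ) ≤ Δ := by linarith
  -- The interval is non-empty exactly when $\Delta>M^3+M$.
  have hab : (M : ℝ) ^ 2 < (1 - (M : ℝ) / Δ) * ((M : ℝ) ^ 2 + 1) := by
    have h1 : (M : ℝ) / Δ * ((M : ℝ) ^ 2 + 1) < 1 := by
      rw [div_mul_eq_mul_div, div_lt_one (by linarith)]
      nlinarith
    linarith
  exact ⟨_, _, le_rfl, by simp, by simp, le_rfl,
    fun k hk => XXZChain.isSpectralGap_hamiltonian hM hΔ hab hk,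
    XXZChain.isSpectralGap_restrictedHamiltonian hM hΔ hab⟩
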